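/- Let $(\Omega,\mathcal F,\mathbb P)$ be a probability space, $X$ a $d$-dimensional random vector and $Y$ a real random variable with $\mathbb E|Y|<\infty$. Let $\bar f:\mathbb R^d\to\mathbb R$ be a Borel regression function, i.e. $\bar f(X)=\mathbb E[Y\mid X]$ a.s. Let $\mathbb P[\,\cdot\mid X=x]$ be a regular conditional version of $\mathbb P$ given $X$, let $\nu$ be a Borel probability measure on $\mathbb R^d$ that is absolutely continuous with respect to the law of $X$, and put $\mathbb P^\nu[A]=\int_{\mathbb R^d}\mathbb P[A\mid X=x]\,d\nu(x)$, with expectation $\mathbb E^\nu$. Suppose that $Y=h(X,V)$ $\mathbb P^\nu$-a.s. for a Borel function $h:\mathbb R^{d+k}\to\mathbb R$ and a $k$-dimensional random vector $V$ that is independent of $X$ under $\mathbb P^\nu$. Define $$C^\nu=\mathbb E^\nu[\bar f(X)^2],\qquad D^\nu=\inf_{f}\mathbb E^\nu\big[(Y-f(X))^2\big],$$ where $f$ ranges over all Borel functions $\mathbb R^d\to\mathbb R$. On a probability space with measure $\mathbb Q$ (for instance $\mathbb P^\nu$ itself, if $\Omega$ is rich enough), let $(X^n,Y^n,V^n)_{n\ge1}$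 be independent copies of $(X,Y,V)$ (with its law under $\mathbb P^\nu$), and let $(\tilde V^n)_{n\ge1}$ be independent copies of $V$ (with its law under $\mathbb P^\nu$) such that the sequence $(\tilde V^n)_{n\ge1}$ is independent of $(X^n,Y^n,V^n)_{n\ge1}$. Put $Z^n=h(X^n,\tilde V^n)$ and $$C^\nu_N=\frac1N\sum_{n=1}^N Y^nZ^n,\qquad D^\nu_N=\frac1N\sum_{n=1}^N Y^n(Y^n-Z^n),$$ $$v^{C,\nu}_N=\frac1{N-1}\sum_{n=1}^N\big(Y^nZ^n-C^\nu_N\big)^2,\qquad v^{D,\nu}_N=\frac1{N-1}\sum_{n=1}^N\big(Y^n(Y^n-Z^n)-D^\nu_N\big)^2 .$$ For $p\in(0,1)$ let $q_p$ be the $p$-quantile of the standard normal distribution. If $\mathbb E^\nu[Y^4]<\infty$, then for every $\alpha\in(0,1)$ $$\liminf_{N\to\infty}\mathbb Q\left[\,|C^\nu-C^\nu_N|\le q_{1-\alpha}\sqrt{\frac{v^{C,\nu}_N}{N}}\,\right]\ge 1-2\alpha$$ and $$\liminf_{N\to\infty}\mathbb Q\left[\,|D^\nu-D^\nu_N|\le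 q_{1-\alpha}\sqrt{\frac{v^{D,\nu}_N}{N}}\,\right]\ge 1-2\alpha .$$ (The bounds carry information for $\alpha\in(0,1/2)$.) -/

import Mathlib

open MeasureTheory ProbabilityTheory Filter
open scoped ENNReal

noncomputable section

/-- The distorted measure `A ↦ ∫ x, κ x A ∂ν`, where `κ x` plays the role of `ℙ[· ∣ X = x]`. -/
def distortedMeasure {Ω E : Type*} [MeasurableSpace Ω] [MeasurableSpace E]
    (κ : Kernel E Ω) (ν : Measure E) : Measure Ω :=
  ν.bind κ

/-- `κ` is a regular conditional version of `P` given `X`: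
`P (X ⁻¹' B ∩ A) = ∫ x in B, κ x A ∂(P.map X)` for all measurable `A`, `B`. -/
def IsRegularConditional {Ω E : Type*} [MeasurableSpace Ω] [MeasurableSpace E]
    (P : Measure Ω) (X : Ω → E) (κ : Kernel E Ω) : Prop :=
  IsMarkovKernel κ ∧ (P.map (fun ω => (X ω, ω))).IsCondKernel κ

/-- `g` is a Borel regression function of `Y` on `X` under `P`: `g(X) = E[Y ∣ X]` almost surely. -/
def IsRegressionFunction {Ω E : Type*} [MeasurableSpace Ω] [mE : MeasurableSpace E]
    (P : Measure Ω) (X : Ω → E) (Y : Ω → ℝ) (g : E → ℝ) : Prop :=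
  Measurable g ∧ (fun ω => g (X ω)) =ᵐ[P] P[Y | MeasurableSpace.comap X mE]

/-- The squared `L²`-norm `E[g(X)²]` of the regression function. -/
def regressionSqNorm {Ω E : Type*} [MeasurableSpace Ω]
    (μ : Measure Ω) (X : Ω → E) (g : E → ℝ) : ℝ :=
  ∫ ω, (g (X ω)) ^ 2 ∂μ

/-- The minimal mean squared distance of `Y` to Borel functions of `X`. The expectation is taken in
`[0, ∞]`, so that functions `f` for which it is infinite do not contribute. -/
def minMeanSqDist {Ω E : Type*} [MeasurableSpace Ω] [MeasurableSpace E]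
    (μ : Measure Ω) (X : Ω → E) (Y : Ω → ℝ) : ℝ :=
  (⨅ (f : E → ℝ) (_ : Measurable f), ∫⁻ ω, ENNReal.ofReal ((Y ω - f (X ω)) ^ 2) ∂μ).toReal

/-- The `p`-quantile of the standard normal distribution, for `0 < p < 1`. -/
def stdNormalQuantile (p : ℝ) : ℝ :=
  sInf {x : ℝ | p ≤ cdf (gaussianReal 0 1) x}

/-- Under `Q`, the triples `(Xs n, Ys n, Vs n)` are independent copies of `(X, Y, V)` under `μ`,
and the `Vt n` are independent copies of `V` under `μ`, independent of all these triples. -/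
structure IsMonteCarloSample {Ω Ω' E F : Type*} [MeasurableSpace Ω] [MeasurableSpace Ω']
    [MeasurableSpace E] [MeasurableSpace F]
    (μ : Measure Ω) (X : Ω → E) (Y : Ω → ℝ) (V : Ω → F)
    (Q : Measure Ω') (Xs : ℕ → Ω' → E) (Ys : ℕ → Ω' → ℝ) (Vs Vt : ℕ → Ω' → F) : Prop where
  measurable_X : ∀ n, Measurable (Xs n)
  measurable_Y : ∀ n, Measurable (Ys n)
  measurable_V : ∀ n, Measurable (Vs n)
  measurable_Vt : ∀ n, Measurable (Vt n)
  law : ∀ n, IdentDistrib (fun ω => (Xs n ω, Ys n ω, Vs n ω)) (fun ω => (X ω, Y ω, V ω)) Q μ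
  law_Vt : ∀ n, IdentDistrib (Vt n) V Q μ
  indep : iIndepFun (fun n ω => (Xs n ω, Ys n ω, Vs n ω)) Q
  indep_Vt : iIndepFun Vt Q
  indep_cross : IndepFun (fun ω n => (Xs n ω, Ys n ω, Vs n ω)) (fun ω n => Vt n ω) Q

/-- The average of the first `N` terms of a sequence. -/
def sampleMean (s : ℕ → ℝ) (N : ℕ) : ℝ :=
  (1 / (N : ℝ)) * ∑ n ∈ Finset.range N, s n

/-- The sample variance of the first `N ≥ 2` terms of a sequence. -/
def sampleVariance (s : ℕ → ℝ) (N : ℕ) : ℝ :=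
  (1 / ((N : ℝ) - 1)) * ∑ n ∈ Finset.range N, (s n - sampleMean s N) ^ 2

end

open scoped Topology

/-! ### Disintegration of the distorted measure along `X` -/

section Distorted

variable {Ω E : Type*} [MeasurableSpace Ω] [MeasurableSpace E] {P : Measure Ω} {X : Ω → E}
  {κ : Kernel E Ω}

/-! Both estimators are empirical means of i.i.d. variables, square integrable because `Y` has a
fourth moment. It remains to identify their means and to prove coverage of the studentized interval.

Means: replacing the law of `X` by `ν` keeps the kernel `κ`, so `fbar` is still a regression
function (`IsRegressionFunction.distortedMeasure`). Given `(X, Y, V)`, the resampled `Z` averages to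
`fbar(X)`; hence `E[YZ] = E[Y fbar(X)] = E[fbar(X)²]` (`integral_mul_resampled`). The infimum `D` is
attained at `fbar`, so `D = E[Y²] - E[fbar(X)²] = E[Y(Y - Z)]` (`minMeanSqDist_eq`).

Coverage (`le_liminf_measureReal_abs_sub_sampleMean_le`): the central limit theorem for the rescaled
error, the strong law for the sample variance, Slutsky and the portmanteau inequality for an open
set bound the liminf below by the Gaussian mass of `(-q, q)`, which is at least `1 - 2α`. -/

theorem IsRegularConditional.hasCondDistrib [IsProbabilityMeasure P] (hX : Measurable X)
    (hκ : IsRegularConditional P X κ) : HasCondDistrib id X κ P where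
  aemeasurable := (hX.prodMk measurable_id).aemeasurable
  map_eq := by
    have h := hκ.2.disintegrate
    have hfst : (P.map fun ω => (X ω, ω)).fst = P.map X :=
      Measure.fst_map_prodMk (Y := fun ω => ω) measurable_id
    rw [hfst] at h
    exact h.symm

/-- Almost every conditional measure is concentrated on the corresponding fibre. -/
theorem IsRegularConditional.ae_ae_eq [IsProbabilityMeasure P] [MeasurableEq E]
    (hX : Measurable X) (hκ : IsRegularConditional P X κ) :
    ∀ᵐ x ∂(P.map X), ∀ᵐ ω ∂(κ x), X ω = x := by
  have := hκ.1
  have hs : MeasurableSet {p : E × Ω | X p.2 = p.1} :=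
    measurableSet_eq_fun (hX.comp measurable_snd) measurable_fst
  have h : ∀ᵐ p ∂(P.map X ⊗ₘ κ), X p.2 = p.1 := by
    rw [← (hκ.hasCondDistrib hX).map_eq,
      ae_map_iff (hX.prodMk measurable_id).aemeasurable hs]
    exact ae_of_all _ fun _ => rfl
  exact Measure.ae_ae_of_ae_compProd h

theorem isProbabilityMeasure_distortedMeasure (hκ : IsMarkovKernel κ) (ν : Measure E)
    [IsProbabilityMeasure ν] : IsProbabilityMeasure (distortedMeasure κ ν) := by
  unfold distortedMeasure; infer_instance

variable [IsProbabilityMeasure P] [MeasurableEq E] {ν : Measure E} [IsProbabilityMeasure ν]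

/-- For `ν`-almost every `x` the measure `κ x` lives on the fibre `X = x`, so `X ω` may be replaced
by `x` under the integral. -/
theorem map_prodMk_distortedMeasure (hX : Measurable X) (hκ : IsRegularConditional P X κ)
    (hν : ν ≪ P.map X) :
    (distortedMeasure κ ν).map (fun ω => (X ω, ω)) = ν ⊗ₘ κ := by
  have := hκ.1
  ext s hs
  have hXi : Measurable fun ω => (X ω, ω) := hX.prodMk measurable_id
  rw [Measure.map_apply hXi hs, distortedMeasure,
    Measure.bind_apply (hXi hs) κ.measurable.aemeasurable, Measure.compProd_apply hs]
  refine lintegral_congr_ae ?_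
  filter_upwards [hν.ae_le (hκ.ae_ae_eq hX)] with x hx
  refine measure_congr ?_
  filter_upwards [hx] with ω hω
  change ((X ω, ω) ∈ s) = ((x, ω) ∈ s)
  rw [hω]

theorem map_distortedMeasure (hX : Measurable X) (hκ : IsRegularConditional P X κ)
    (hν : ν ≪ P.map X) : (distortedMeasure κ ν).map X = ν := by
  have := hκ.1
  rw [← Measure.fst_map_prodMk (X := X) (Y := fun ω => ω) measurable_id,
    map_prodMk_distortedMeasure hX hκ hν, Measure.fst_compProd]

theorem hasCondDistrib_distortedMeasure (hX : Measurable X) (hκ : IsRegularConditional P X κ)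
    (hν : ν ≪ P.map X) : HasCondDistrib id X κ (distortedMeasure κ ν) where
  aemeasurable := (hX.prodMk measurable_id).aemeasurable
  map_eq := by
    rw [map_distortedMeasure hX hκ hν]
    exact map_prodMk_distortedMeasure hX hκ hν

end Distorted

/-! ### Regression functions under a change of the law of `X` -/

section Regression

variable {Ω E : Type*} [MeasurableSpace Ω] [mE : MeasurableSpace E] {P : Measure Ω} {X : Ω → E}
  {κ : Kernel E Ω} {Y : Ω → ℝ} {g : E → ℝ}

theorem condExp_ae_eq_integral_of_hasCondDistrib [IsProbabilityMeasure P] [IsMarkovKernel κ]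
    (hX : Measurable X) (hY : Measurable Y) (hYint : Integrable Y P)
    (h : HasCondDistrib id X κ P) :
    P[Y | MeasurableSpace.comap X mE] =ᵐ[P] fun ω => ∫ ω', Y ω' ∂(κ (X ω)) := by
  have hc := condDistrib_ae_eq_of_measure_eq_compProd X hY.aemeasurable (h.comp_left hY).map_eq
  filter_upwards [condExp_ae_eq_integral_condDistrib' hX hYint,
    ae_of_ae_map hX.aemeasurable hc] with ω h1 h2
  rw [h1, h2, Kernel.map_apply _ hY, integral_map hY.aemeasurable (by fun_prop)]

/-- A regression function under `P` is also one under the distorted measure. -/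
theorem IsRegressionFunction.distortedMeasure [IsProbabilityMeasure P] [MeasurableEq E]
    {ν : Measure E} [IsProbabilityMeasure ν] (hg : IsRegressionFunction P X Y g)
    (hX : Measurable X) (hY : Measurable Y) (hYint : Integrable Y P)
    (hκ : IsRegularConditional P X κ) (hν : ν ≪ P.map X)
    (hYint' : Integrable Y (distortedMeasure κ ν)) :
    IsRegressionFunction (distortedMeasure κ ν) X Y g := by
  have := hκ.1
  have := isProbabilityMeasure_distortedMeasure hκ.1 ν
  refine ⟨hg.1, ?_⟩
  have hgm := hg.1
  -- Unlike the conditional expectation, this identity lives on the state space of `X`, where it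
  -- passes to `ν` by absolute continuity.
  have h1 : ∀ᵐ x ∂(P.map X), g x = ∫ ω', Y ω' ∂(κ x) := by
    rw [ae_map_iff hX.aemeasurable]
    · filter_upwards [hg.2, condExp_ae_eq_integral_of_hasCondDistrib hX hY hYint
        (hκ.hasCondDistrib hX)] with ω h1 h2
      rw [h1, h2]
    · exact measurableSet_eq_fun hgm
        (StronglyMeasurable.integral_kernel hY.stronglyMeasurable).measurable
  have h2 := hν.ae_le h1
  rw [← map_distortedMeasure hX hκ hν] at h2
  filter_upwards [ae_of_ae_map hX.aemeasurable h2, condExp_ae_eq_integral_of_hasCondDistrib hX hY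
    hYint' (hasCondDistrib_distortedMeasure hX hκ hν)] with ω h1 h2
  rw [h1, h2]

end Regression

/-! ### Independence of a sequence of pairs -/

section IndependentPairs

variable {Ω ι E F : Type*} [MeasurableSpace Ω] [MeasurableSpace E] [MeasurableSpace F]
  {Q : Measure Ω}

/-- If two independent processes have independent terms, then so has the process of pairs. -/
theorem iIndepFun_prodMk_of_indepFun {A : ι → Ω → E} {B : ι → Ω → F}
    (hAm : ∀ i, Measurable (A i)) (hBm : ∀ i, Measurable (B i))
    (hA : iIndepFun A Q) (hB : iIndepFun B Q)
    (hAB : IndepFun (fun ω i => A i ω) (fun ω i => B i ω) Q) :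
    iIndepFun (fun i ω => (A i ω, B i ω)) Q := by
  have hpair (i : ι) : IndepFun (A i) (B i) Q :=
    hAB.comp (φ := fun a : ι → E => a i) (ψ := fun b : ι → F => b i) (measurable_pi_apply i)
      (measurable_pi_apply i)
  rw [iIndepFun_iff_iIndep]
  -- Preimages of measurable rectangles form a π-system generating the σ-algebra of each pair, so
  -- the product formula is needed only there.
  refine iIndepSets.iIndep (fun i => ((hAm i).prodMk (hBm i)).comap_le)
    (fun i => Set.preimage (fun ω => (A i ω, B i ω)) ''
      Set.image2 (· ×ˢ ·) {s : Set E | MeasurableSet s} {t : Set F | MeasurableSet t})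
    (fun i => ?_) (fun i => ?_) ?_
  · exact isPiSystem_prod.comap _
  · rw [← generateFrom_prod, MeasurableSpace.comap_generateFrom]
  rw [iIndepSets_iff]
  intro S f hf
  choose! g hg hgf using hf
  simp only [Set.image2, Set.mem_ofPred_eq] at hg
  choose! s hs t ht hst using hg
  have hf' (i : ι) (hi : i ∈ S) : f i = A i ⁻¹' s i ∩ B i ⁻¹' t i := by
    rw [← hgf i hi, ← hst i hi]
    rfl
  have h1 : ⋂ i ∈ S, f i = (⋂ i ∈ S, A i ⁻¹' s i) ∩ ⋂ i ∈ S, B i ⁻¹' t i := by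
    simp_rw [← Set.iInter_inter_distrib]
    exact Set.iInter₂_congr hf'
  have h2 : Q ((⋂ i ∈ S, A i ⁻¹' s i) ∩ ⋂ i ∈ S, B i ⁻¹' t i)
      = Q (⋂ i ∈ S, A i ⁻¹' s i) * Q (⋂ i ∈ S, B i ⁻¹' t i) := by
    have h := hAB.measure_inter_preimage_eq_mul (⋂ i ∈ S, (fun a : ι → E => a i) ⁻¹' s i)
      (⋂ i ∈ S, (fun b : ι → F => b i) ⁻¹' t i)
      (S.measurableSet_biInter fun i hi => measurable_pi_apply i (hs i hi))
      (S.measurableSet_biInter fun i hi => measurable_pi_apply i (ht i hi))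
    simpa only [Set.preimage_iInter] using! h
  rw [h1, h2, hA.measure_inter_preimage_eq_mul S hs, hB.measure_inter_preimage_eq_mul S ht,
    ← Finset.prod_mul_distrib]
  refine Finset.prod_congr rfl fun i hi => ?_
  rw [hf' i hi, (hpair i).measure_inter_preimage_eq_mul _ _ (hs i hi) (ht i hi)]

end IndependentPairs

/-! ### Regression, orthogonality and least squares -/

section RegressionIdentities

variable {Ω E F : Type*} [MeasurableSpace Ω] [mE : MeasurableSpace E] [MeasurableSpace F]
  {μ : Measure Ω} {X : Ω → E} {Y : Ω → ℝ} {V : Ω → F} {g : E → ℝ}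
  {h : E × F → ℝ}

/-- The regression function of `h (X, V)` on `X` integrates out the independent variable `V`. -/
theorem IsRegressionFunction.ae_eq_integral_of_indepFun [IsProbabilityMeasure μ]
    (hg : IsRegressionFunction μ X Y g)
    (hX : Measurable X) (hV : Measurable V) (hh : Measurable h) (hXV : IndepFun X V μ)
    (hYh : ∀ᵐ ω ∂μ, Y ω = h (X ω, V ω)) (hYint : Integrable Y μ) :
    ∀ᵐ ω ∂μ, g (X ω) = ∫ v, h (X ω, v) ∂(μ.map V) := by
  have := Measure.isProbabilityMeasure_map hV.aemeasurable (μ := μ)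
  have := Measure.isProbabilityMeasure_map hX.aemeasurable (μ := μ)
  set H : E → ℝ := fun x => ∫ v, h (x, v) ∂(μ.map V)
  have hHm : StronglyMeasurable H := hh.stronglyMeasurable.integral_prod_right'
  have hlaw : μ.map (fun ω => (X ω, V ω)) = (μ.map X).prod (μ.map V) :=
    (indepFun_iff_map_prod_eq_prod_map_map hX.aemeasurable hV.aemeasurable).1 hXV
  have hhY : Integrable (fun ω => h (X ω, V ω)) μ := hYint.congr hYh
  have hhint : Integrable h ((μ.map X).prod (μ.map V)) := by
    rw [← hlaw, integrable_map_measure hh.aestronglyMeasurable (hX.prodMk hV).aemeasurable]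
    exact hhY
  have hHint : Integrable (H ∘ X) μ := hhint.integral_prod_left.comp_measurable hX
  refine hg.2.trans (ae_eq_condExp_of_forall_setIntegral_eq hX.comap_le hYint
    (fun _ _ _ => hHint.integrableOn) ?_ ?_).symm
  -- The law of `(X, V)` is a product, so Fubini integrates `V` out over `s ×ˢ univ`.
  · rintro _ ⟨s, hs, rfl⟩ -
    have h1 : ∫ ω in X ⁻¹' s, H (X ω) ∂μ = ∫ x in s, H x ∂(μ.map X) :=
      (setIntegral_map hs hHm.aestronglyMeasurable hX.aemeasurable).symm
    have h2 : ∫ ω in X ⁻¹' s, h (X ω, V ω) ∂μ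
        = ∫ p in s ×ˢ Set.univ, h p ∂((μ.map X).prod (μ.map V)) := by
      rw [← hlaw, setIntegral_map (hs.prod MeasurableSet.univ) hh.aestronglyMeasurable
        (hX.prodMk hV).aemeasurable]
      congr 2
      ext; simp
    rw [integral_congr_ae (ae_restrict_of_ae hYh), h2, setIntegral_prod _ hhint.integrableOn]
    simp only [Measure.restrict_univ]
    exact h1
  · exact (hHm.comp_measurable (comap_measurable X)).aestronglyMeasurable

theorem IsRegressionFunction.memLp {p : ℝ≥0∞} (hg : IsRegressionFunction μ X Y g)
    (hp : 1 ≤ p) (hY : MemLp Y p μ) : MemLp (fun ω => g (X ω)) p μ :=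
  (memLp_congr_ae hg.2).2 (hY.condExp hp)

/-- The regression residual is orthogonal to the square integrable functions of `X`. -/
theorem IsRegressionFunction.integral_mul_eq [IsProbabilityMeasure μ]
    (hg : IsRegressionFunction μ X Y g)
    (hX : Measurable X) (hY : MemLp Y 2 μ) {f : E → ℝ} (hf : Measurable f)
    (hfX : MemLp (fun ω => f (X ω)) 2 μ) :
    ∫ ω, f (X ω) * Y ω ∂μ = ∫ ω, f (X ω) * g (X ω) ∂μ := by
  have hfm : StronglyMeasurable[MeasurableSpace.comap X mE] (fun ω => f (X ω)) :=
    hf.stronglyMeasurable.comp_measurable (comap_measurable X)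
  have h1 := condExp_mul_of_stronglyMeasurable_left hfm (hfX.integrable_mul hY)
    (hY.integrable one_le_two)
  rw [← integral_condExp hX.comap_le]
  refine integral_congr_ae ?_
  filter_upwards [h1, hg.2] with ω h1 h2
  rw [h2]
  exact h1

/-- The minimal mean squared distance is attained at the regression function. -/
theorem IsRegressionFunction.minMeanSqDist_eq [IsProbabilityMeasure μ]
    (hg : IsRegressionFunction μ X Y g)
    (hX : Measurable X) (hYm : Measurable Y) (hY : MemLp Y 2 μ) :
    minMeanSqDist μ X Y = (∫ ω, Y ω ^ 2 ∂μ) - regressionSqNorm μ X g := by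
  have hgX : MemLp (fun ω => g (X ω)) 2 μ := hg.memLp one_le_two hY
  -- Pythagoras: expand both squares; `Y` and `g(X)` have the same cross term with `f(X)`.
  have hexp (f : E → ℝ) (hf : Measurable f) (hfX : MemLp (fun ω => f (X ω)) 2 μ) :
      ∫ ω, (Y ω - f (X ω)) ^ 2 ∂μ
        = ((∫ ω, Y ω ^ 2 ∂μ) - regressionSqNorm μ X g) + ∫ ω, (g (X ω) - f (X ω)) ^ 2 ∂μ := by
    have hYf := hg.integral_mul_eq hX hY hf hfX
    have e (Z : Ω → ℝ) (hZ : MemLp Z 2 μ) : ∫ ω, (Z ω - f (X ω)) ^ 2 ∂μ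
        = (∫ ω, Z ω ^ 2 ∂μ) - 2 * (∫ ω, f (X ω) * Z ω ∂μ) + ∫ ω, f (X ω) ^ 2 ∂μ := by
      have i1 := hZ.integrable_sq
      have i2 : Integrable (fun ω => 2 * (f (X ω) * Z ω)) μ :=
        (hfX.integrable_mul hZ).const_mul 2
      have i3 : Integrable (fun ω => Z ω ^ 2 - 2 * (f (X ω) * Z ω)) μ := i1.sub i2
      rw [← integral_const_mul, ← integral_sub i1 i2, ← integral_add i3 hfX.integrable_sq]
      exact integral_congr_ae (ae_of_all _ fun ω => by ring)
    rw [e Y hY, e _ hgX, hYf, regressionSqNorm]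
    ring
  set D := (∫ ω, Y ω ^ 2 ∂μ) - regressionSqNorm μ X g
  have hD : ∫ ω, (Y ω - g (X ω)) ^ 2 ∂μ = D := by
    rw [hexp g hg.1 hgX]
    simp
  have hD0 : 0 ≤ D := hD ▸ integral_nonneg fun _ => sq_nonneg _
  have hmin : (⨅ (f : E → ℝ) (_ : Measurable f),
      ∫⁻ ω, ENNReal.ofReal ((Y ω - f (X ω)) ^ 2) ∂μ) = ENNReal.ofReal D := by
    refine le_antisymm (iInf₂_le_of_le g hg.1 ?_) (le_iInf₂ fun f hf => ?_)
    · rw [← hD]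
      exact (ofReal_integral_eq_lintegral_ofReal (hY.sub hgX).integrable_sq
        (ae_of_all _ fun _ => sq_nonneg _)).ge
    -- An infinite distance is no competitor; a finite one puts `f(X) = Y - (Y - f(X))` in `L²`,
    -- where `hexp` applies.
    · by_cases hfin : ∫⁻ ω, ENNReal.ofReal ((Y ω - f (X ω)) ^ 2) ∂μ = ∞
      · rw [hfin]; exact le_top
      have hYfm : AEStronglyMeasurable (fun ω => Y ω - f (X ω)) μ :=
        (hYm.sub (hf.comp hX)).aestronglyMeasurable
      have hint : Integrable (fun ω => (Y ω - f (X ω)) ^ 2) μ :=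
        (lintegral_ofReal_ne_top_iff_integrable (hYfm.pow 2)
          (ae_of_all _ fun _ => sq_nonneg _)).1 hfin
      have hfX : MemLp (fun ω => f (X ω)) 2 μ := by
        have := hY.sub ((memLp_two_iff_integrable_sq hYfm).2 hint)
        refine (memLp_congr_ae (ae_of_all _ fun ω => ?_)).1 this
        simp
      rw [← ofReal_integral_eq_lintegral_ofReal hint (ae_of_all _ fun _ => sq_nonneg _),
        hexp f hf hfX]
      exact ENNReal.ofReal_le_ofReal
        (le_add_of_nonneg_right (integral_nonneg fun _ => sq_nonneg _))
  rw [minMeanSqDist, hmin, ENNReal.toReal_ofReal hD0]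

end RegressionIdentities

/-! ### The Monte Carlo sample and its means -/

section MonteCarlo

variable {Ω Ω' E F : Type*} [MeasurableSpace Ω] [MeasurableSpace Ω'] [mE : MeasurableSpace E]
  [MeasurableSpace F] {μ : Measure Ω} {X : Ω → E} {Y : Ω → ℝ}
  {V : Ω → F} {g : E → ℝ} {h : E × F → ℝ} {Q : Measure Ω'}
  {Xs : ℕ → Ω' → E} {Ys : ℕ → Ω' → ℝ} {Vs Vt : ℕ → Ω' → F}

namespace IsMonteCarloSample

theorem iIndepFun_prodMk (hs : IsMonteCarloSample μ X Y V Q Xs Ys Vs Vt) :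
    iIndepFun (fun n ω => ((Xs n ω, Ys n ω, Vs n ω), Vt n ω)) Q :=
  iIndepFun_prodMk_of_indepFun
    (fun n => (hs.measurable_X n).prodMk ((hs.measurable_Y n).prodMk (hs.measurable_V n)))
    hs.measurable_Vt hs.indep hs.indep_Vt hs.indep_cross

theorem indepFun_triple
    (hs : IsMonteCarloSample μ X Y V Q Xs Ys Vs Vt) (n : ℕ) :
    IndepFun (fun ω => (Xs n ω, Ys n ω, Vs n ω)) (Vt n) Q :=
  hs.indep_cross.comp (φ := fun a : ℕ → E × ℝ × F => a n) (ψ := fun b : ℕ → F => b n) (measurable_pi_apply n)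
    (measurable_pi_apply n)

theorem identDistrib_prodMk [IsProbabilityMeasure Q]
    (hs : IsMonteCarloSample μ X Y V Q Xs Ys Vs Vt) (n : ℕ) :
    IdentDistrib (fun ω => ((Xs n ω, Ys n ω, Vs n ω), Vt n ω))
      (fun ω => ((Xs 0 ω, Ys 0 ω, Vs 0 ω), Vt 0 ω)) Q Q :=
  ((hs.law n).trans (hs.law 0).symm).prodMk ((hs.law_Vt n).trans (hs.law_Vt 0).symm)
    (hs.indepFun_triple n) (hs.indepFun_triple 0)

theorem identDistrib_Y (hs : IsMonteCarloSample μ X Y V Q Xs Ys Vs Vt) (n : ℕ) :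
    IdentDistrib (Ys n) Y Q μ :=
  (hs.law n).comp (u := fun p : E × ℝ × F => p.2.1) (by fun_prop)

/-- `Xs n` and `Vt n` are independent, as are `X` and `V`, so both pairs have the same product law.
-/
theorem identDistrib_resampled [IsProbabilityMeasure μ] [IsProbabilityMeasure Q]
    (hs : IsMonteCarloSample μ X Y V Q Xs Ys Vs Vt)
    (hh : Measurable h) (hXV : IndepFun X V μ) (hYm : AEMeasurable Y μ)
    (hYh : ∀ᵐ ω ∂μ, Y ω = h (X ω, V ω)) (n : ℕ) :
    IdentDistrib (fun ω => h (Xs n ω, Vt n ω)) Y Q μ := by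
  have h1 : IdentDistrib (Xs n) X Q μ := (hs.law n).comp (u := fun p : E × ℝ × F => p.1) (by fun_prop)
  have h2 : IndepFun (Xs n) (Vt n) Q :=
    (hs.indepFun_triple n).comp (φ := fun p : E × ℝ × F => p.1) (ψ := id) (by fun_prop) measurable_id
  exact ((h1.prodMk (hs.law_Vt n) h2 hXV).comp hh).trans
    (IdentDistrib.of_ae_eq hYm hYh).symm

/-- Resampling `V` turns the product into an unbiased estimator of the squared norm of the
regression function. -/
theorem integral_mul_resampled [IsProbabilityMeasure μ] [IsProbabilityMeasure Q]
    (hs : IsMonteCarloSample μ X Y V Q Xs Ys Vs Vt)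
    (hg : IsRegressionFunction μ X Y g) (hX : Measurable X) (hY : Measurable Y)
    (hV : Measurable V) (hh : Measurable h)
    (hXV : IndepFun X V μ) (hYh : ∀ᵐ ω ∂μ, Y ω = h (X ω, V ω)) (hY2 : MemLp Y 2 μ) (n : ℕ) :
    ∫ ω, Ys n ω * h (Xs n ω, Vt n ω) ∂Q = regressionSqNorm μ X g := by
  have := Measure.isProbabilityMeasure_map hV.aemeasurable (μ := μ)
  have hT : Measurable fun ω => (X ω, Y ω, V ω) := hX.prodMk (hY.prodMk hV)
  have := Measure.isProbabilityMeasure_map hT.aemeasurable (μ := μ)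
  have hTs : Measurable fun ω => (Xs n ω, Ys n ω, Vs n ω) :=
    (hs.measurable_X n).prodMk ((hs.measurable_Y n).prodMk (hs.measurable_V n))
  have hVt := hs.measurable_Vt n
  have hlaw : Q.map (fun ω => ((Xs n ω, Ys n ω, Vs n ω), Vt n ω))
      = (μ.map fun ω => (X ω, Y ω, V ω)).prod (μ.map V) := by
    rw [(indepFun_iff_map_prod_eq_prod_map_map hTs.aemeasurable hVt.aemeasurable).1
      (hs.indepFun_triple n), (hs.law n).map_eq, (hs.law_Vt n).map_eq]
  have hφ : Measurable fun p : (E × ℝ × F) × F => p.1.2.1 * h (p.1.1, p.2) := by fun_prop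
  have hZ := (hs.identDistrib_resampled hh hXV hY.aemeasurable hYh n).memLp_iff.2 hY2
  have hint : Integrable (fun p : (E × ℝ × F) × F => p.1.2.1 * h (p.1.1, p.2))
      ((μ.map fun ω => (X ω, Y ω, V ω)).prod (μ.map V)) := by
    rw [← hlaw, integrable_map_measure hφ.aestronglyMeasurable (hTs.prodMk hVt).aemeasurable]
    exact ((hs.identDistrib_Y n).memLp_iff.2 hY2).integrable_mul hZ
  calc ∫ ω, Ys n ω * h (Xs n ω, Vt n ω) ∂Q
      = ∫ p, p.1.2.1 * h (p.1.1, p.2) ∂((μ.map fun ω => (X ω, Y ω, V ω)).prod (μ.map V)) := by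
        rw [← hlaw, integral_map (hTs.prodMk hVt).aemeasurable hφ.aestronglyMeasurable]
    _ = ∫ ω, (∫ v, Y ω * h (X ω, v) ∂(μ.map V)) ∂μ := by
        rw [integral_prod _ hint, integral_map hT.aemeasurable
          hφ.stronglyMeasurable.integral_prod_right'.aestronglyMeasurable]
    -- Averaging over the resampled variable alone turns `h (X, ·)` into `g(X)`.
    _ = ∫ ω, g (X ω) * Y ω ∂μ := by
        refine integral_congr_ae ?_
        filter_upwards [hg.ae_eq_integral_of_indepFun hX hV hh hXV hYh
          (hY2.integrable one_le_two)] with ω hω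
        rw [integral_const_mul, ← hω, mul_comm]
    _ = regressionSqNorm μ X g := by
        rw [hg.integral_mul_eq hX hY2 hg.1 (hg.memLp one_le_two hY2), regressionSqNorm]
        simp only [sq]

end IsMonteCarloSample

end MonteCarlo

/-! ### Standard normal quantiles -/

theorem le_cdf_stdNormalQuantile {p : ℝ} (hp : p ∈ Set.Ioo (0 : ℝ) 1) :
    p ≤ cdf (gaussianReal 0 1) (stdNormalQuantile p) := by
  set F := cdf (gaussianReal 0 1)
  have hne : {x : ℝ | p ≤ F x}.Nonempty :=
    ((tendsto_cdf_atTop (gaussianReal 0 1)).eventually_const_le hp.2).exists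
  -- Right continuity makes the infimum belong to the set that defines the quantile.
  have hright : Tendsto F (𝓝[>] (stdNormalQuantile p)) (𝓝 (F (stdNormalQuantile p))) :=
    ((F.right_continuous _).mono Set.Ioi_subset_Ici_self)
  refine ge_of_tendsto hright ?_
  filter_upwards [self_mem_nhdsWithin] with y hy
  obtain ⟨x, hx, hxy⟩ := exists_lt_of_csInf_lt hne hy
  exact hx.trans (F.mono hxy.le)

/-- A symmetric interval bounded by the `(1 - α)`-quantile has standard normal probability at
least `1 - 2 α`. -/
theorem le_gaussianReal_abs_lt_quantile {α : ℝ} (hα : α ∈ Set.Ioo (0 : ℝ) 1) :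
    1 - 2 * α ≤ (gaussianReal 0 1).real {x | |x| < stdNormalQuantile (1 - α)} := by
  set q := stdNormalQuantile (1 - α)
  have hna : NullSingletonClass (gaussianReal 0 1) :=
    nullSingletonClass_gaussianReal one_ne_zero
  have hq : 1 - α ≤ (gaussianReal 0 1).real (Set.Iic q) := by
    rw [← cdf_eq_real]
    exact le_cdf_stdNormalQuantile ⟨by linarith [hα.2], by linarith [hα.1]⟩
  have hIci : (gaussianReal 0 1).real (Set.Ici q) ≤ α := by
    have h1 : (gaussianReal 0 1).real (Set.Ici q) = (gaussianReal 0 1).real (Set.Ioi q) :=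
      measureReal_congr Ioi_ae_eq_Ici.symm
    rw [h1, ← Set.compl_Iic, probReal_compl_eq_one_sub measurableSet_Iic]
    linarith
  -- The left tail is the reflection of the right one.
  have hIic : (gaussianReal 0 1).real (Set.Iic (-q)) ≤ α := by
    have h1 : (gaussianReal 0 1).map (fun x => -x) = gaussianReal 0 1 := by
      rw [gaussianReal_map_neg, neg_zero]
    rw [← h1, map_measureReal_apply measurable_neg measurableSet_Iic]
    convert hIci using 2
    ext x
    simp
  have hcover : {x : ℝ | |x| < q}ᶜ ⊆ Set.Iic (-q) ∪ Set.Ici q := by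
    intro x hx
    simp only [Set.mem_compl_iff, Set.mem_ofPred_eq, not_lt, le_abs] at hx
    rcases hx with hx | hx
    · exact Or.inr hx
    · exact Or.inl (by simp only [Set.mem_Iic]; linarith)
  have h1 := (measureReal_mono hcover (μ := gaussianReal 0 1)).trans (measureReal_union_le _ _)
  rw [probReal_compl_eq_one_sub (measurableSet_lt (by fun_prop) measurable_const)] at h1
  linarith

/-! ### Convergence of the sample variance -/

section SampleVariance

theorem sampleMean_eq_div (s : ℕ → ℝ) (N : ℕ) :
    sampleMean s N = (∑ n ∈ Finset.range N, s n) / N := by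
  rw [sampleMean, one_div, div_eq_inv_mul]

theorem sampleVariance_eq (s : ℕ → ℝ) {N : ℕ} (hN : 2 ≤ N) :
    sampleVariance s N =
      (N / ((N : ℝ) - 1)) * (sampleMean (fun n => s n ^ 2) N - sampleMean s N ^ 2) := by
  have hN' : (2 : ℝ) ≤ N := by exact_mod_cast hN
  have h0 : (N : ℝ) ≠ 0 := by linarith
  have h1 : (N : ℝ) - 1 ≠ 0 := by linarith
  have hs : ∑ n ∈ Finset.range N, s n = N * sampleMean s N := by
    rw [sampleMean]; field_simp
  have : ∑ n ∈ Finset.range N, (s n - sampleMean s N) ^ 2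
      = ∑ n ∈ Finset.range N, s n ^ 2 - N * sampleMean s N ^ 2 := by
    simp only [sub_sq, Finset.sum_add_distrib, Finset.sum_sub_distrib, Finset.sum_const,
      Finset.card_range, nsmul_eq_mul, ← Finset.mul_sum, ← Finset.sum_mul, hs]
    ring
  have hs2 : ∑ n ∈ Finset.range N, s n ^ 2 = N * sampleMean (fun n => s n ^ 2) N := by
    rw [sampleMean]; field_simp
  rw [sampleVariance, this, hs2]
  field_simp

theorem tendsto_sampleVariance {s : ℕ → ℝ} {m m₂ : ℝ}
    (h1 : Tendsto (sampleMean s) atTop (𝓝 m))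
    (h2 : Tendsto (sampleMean fun n => s n ^ 2) atTop (𝓝 m₂)) :
    Tendsto (sampleVariance s) atTop (𝓝 (m₂ - m ^ 2)) := by
  have h3 : Tendsto (fun N : ℕ => (N : ℝ) / ((N : ℝ) - 1)) atTop (𝓝 1) := by
    simpa [sub_eq_add_neg] using tendsto_natCast_div_add_atTop (𝕜 := ℝ) (-1)
  have h4 := h3.mul (h2.sub (h1.pow 2))
  rw [one_mul] at h4
  refine h4.congr' ?_
  filter_upwards [eventually_ge_atTop 2] with N hN
  rw [sampleVariance_eq s hN]

end SampleVariance

/-! ### Asymptotic coverage for i.i.d. sequences -/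

section ConfidenceInterval

variable {Ω : Type*} [MeasurableSpace Ω] {Q : Measure Ω} [IsProbabilityMeasure Q]
  {W : ℕ → Ω → ℝ}

/-- The strong law is applied to `W` and to its squares. -/
theorem ae_tendsto_sampleVariance (hW : MemLp (W 0) 2 Q) (hindep : iIndepFun W Q)
    (hident : ∀ n, IdentDistrib (W n) (W 0) Q Q) :
    ∀ᵐ ω ∂Q, Tendsto (fun N => sampleVariance (fun n => W n ω) N) atTop (𝓝 Var[W 0; Q]) := by
  have h1 := strong_law_ae_real W (hW.integrable one_le_two)
    (fun _ _ hij => hindep.indepFun hij) hident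
  have h2 := strong_law_ae_real (fun n ω => W n ω ^ 2) hW.integrable_sq
    (fun _ _ hij => (hindep.indepFun hij).comp (φ := fun x => x ^ 2) (ψ := fun x => x ^ 2)
      (by fun_prop) (by fun_prop))
    (fun n => (hident n).comp (u := fun x => x ^ 2) (by fun_prop))
  filter_upwards [h1, h2] with ω h1 h2
  have hv : Var[W 0; Q] = (∫ ω, W 0 ω ^ 2 ∂Q) - (∫ ω, W 0 ω ∂Q) ^ 2 := by
    rw [variance_eq_sub hW]; rfl
  rw [hv]
  refine tendsto_sampleVariance ?_ ?_
  · simpa only [sampleMean_eq_div, funext (sampleMean_eq_div _)] using h1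
  · simpa only [sampleMean_eq_div, funext (sampleMean_eq_div _)] using h2

theorem measurable_sampleMean (hW : ∀ n, Measurable (W n)) (N : ℕ) :
    Measurable fun ω => sampleMean (fun n => W n ω) N := by
  unfold sampleMean; fun_prop

theorem measurable_sampleVariance (hW : ∀ n, Measurable (W n)) (N : ℕ) :
    Measurable fun ω => sampleVariance (fun n => W n ω) N := by
  have := measurable_sampleMean hW N
  unfold sampleVariance; fun_prop

/-- The error inequality, rescaled by `√N`. -/
theorem abs_sub_le_mul_sqrt_div_of_lt {N : ℕ} (hN : 0 < N) {m S q v : ℝ}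
    (h : |(√N)⁻¹ * (S - N * m)| - q * √v < 0) :
    |m - S / N| ≤ q * √(v / N) := by
  have hN' : (0 : ℝ) < N := by exact_mod_cast hN
  have hs : 0 < √(N : ℝ) := Real.sqrt_pos.2 hN'
  have hss : √(N : ℝ) * √(N : ℝ) = N := Real.mul_self_sqrt hN'.le
  have h1 : m - S / N = -((√N)⁻¹ * ((√N)⁻¹ * (S - N * m))) := by
    rw [← mul_assoc, ← mul_inv, hss]
    field_simp
    ring
  rw [h1, abs_neg, abs_mul, abs_of_pos (inv_pos.2 hs), Real.sqrt_div' _ hN'.le, div_eq_inv_mul,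
    mul_left_comm]
  exact mul_le_mul_of_nonneg_left (by linarith) (inv_pos.2 hs).le

/-- Bounding a real-valued liminf from below requires this side condition. -/
theorem isCoboundedUnder_ge_measureReal (s : ℕ → Set Ω) :
    IsCoboundedUnder (· ≥ ·) atTop (fun N => Q.real (s N)) :=
  (isBoundedUnder_of ⟨1, fun _ => measureReal_le_one⟩ :
    IsBoundedUnder (· ≤ ·) atTop _).isCoboundedUnder_ge

/-- Asymptotic coverage of the studentized confidence interval for the mean of an i.i.d.
sequence of square integrable random variables. -/
theorem le_liminf_measureReal_abs_sub_sampleMean_le (hWm : ∀ n, Measurable (W n))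
    (hW : MemLp (W 0) 2 Q) (hindep : iIndepFun W Q)
    (hident : ∀ n, IdentDistrib (W n) (W 0) Q Q) {m : ℝ} (hm : ∫ ω, W 0 ω ∂Q = m)
    {α : ℝ} (hα : α ∈ Set.Ioo (0 : ℝ) 1) :
    1 - 2 * α ≤ liminf (fun N : ℕ => Q.real {ω |
        |m - sampleMean (fun n => W n ω) N|
          ≤ stdNormalQuantile (1 - α) * √(sampleVariance (fun n => W n ω) N / N)}) atTop := by
  set q := stdNormalQuantile (1 - α)
  -- In the degenerate case the limiting strict inequality would read `0 < 0`; but then all `W n`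
  -- equal `m` almost surely and the closed inequality reads `0 ≤ 0`.
  by_cases hvar : Var[W 0; Q] = 0
  · have hconst : ∀ᵐ ω ∂Q, ∀ n, W n ω = m := by
      refine ae_all_iff.2 fun n => ?_
      have h1 := ae_eq_integral_of_variance_eq_zero ((hident n).memLp_iff.2 hW)
        (by rw [(hident n).variance_eq, hvar])
      rwa [(hident n).integral_eq, hm] at h1
    refine le_liminf_of_le (isCoboundedUnder_ge_measureReal _) ?_
    filter_upwards [eventually_gt_atTop 0] with N hN
    have hN' : (N : ℝ) ≠ 0 := by exact_mod_cast hN.ne'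
    have : {ω | |m - sampleMean (fun n => W n ω) N|
          ≤ q * √(sampleVariance (fun n => W n ω) N / N)} =ᵐ[Q] (Set.univ : Set Ω) := by
      rw [eventuallyEq_univ]
      filter_upwards [hconst] with ω hω
      have hmean : sampleMean (fun n => W n ω) N = m := by
        simp [sampleMean, hω, hN']
      have hvar : sampleVariance (fun n => W n ω) N = 0 := by
        rw [sampleVariance, hmean]
        simp [hω]
      rw [hmean, hvar]
      simp
    rw [measureReal_congr this, probReal_univ]
    linarith [hα.1]
  have hpos : 0 < Var[W 0; Q] := lt_of_le_of_ne (variance_nonneg _ _) (Ne.symm hvar)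
  set σ := √Var[W 0; Q] with hσ
  have hσpos : 0 < σ := Real.sqrt_pos.2 hpos
  have hlaw : HasLaw (fun x : ℝ => σ * x) (gaussianReal 0 Var[W 0; Q].toNNReal)
      (gaussianReal 0 1) := by
    refine ⟨by fun_prop, ?_⟩
    rw [gaussianReal_map_const_mul]
    congr 1
    · simp
    · ext
      simp [hσ, Real.sq_sqrt hpos.le, hpos.le]
  have hclt := tendstoInDistribution_inv_sqrt_mul_sum_sub hlaw hW hindep hident
  have hvm := measurable_sampleVariance hWm
  have hslln : TendstoInMeasure Q (fun N ω => sampleVariance (fun n => W n ω) N) atTop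
      (fun _ => Var[W 0; Q]) :=
    tendstoInMeasure_of_tendsto_ae (fun N => (hvm N).aestronglyMeasurable)
      (ae_tendsto_sampleVariance hW hindep hident)
  -- Coverage is encoded as negativity of a continuous function of error and variance, which avoids
  -- dividing by a sample variance that may vanish.
  have hslutsky := hclt.continuous_comp_prodMk_of_tendstoInMeasure_const
    (g := fun p : ℝ × ℝ => |p.1| - q * √p.2) (by fun_prop) hslln (fun N => (hvm N).aemeasurable)
  have hopen := ProbabilityMeasure.le_liminf_measure_open_of_tendsto hslutsky.tendsto
    (isOpen_Iio (a := (0 : ℝ)))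
  simp only [ProbabilityMeasure.coe_mk] at hopen
  have hleft : ENNReal.ofReal (1 - 2 * α) ≤
      (gaussianReal 0 1).map (fun x : ℝ => |σ * x| - q * √Var[W 0; Q]) (Set.Iio 0) := by
    rw [Measure.map_apply (by fun_prop) measurableSet_Iio]
    have hset : (fun x : ℝ => |σ * x| - q * √Var[W 0; Q]) ⁻¹' Set.Iio 0 = {x | |x| < q} := by
      ext x
      simp only [Set.mem_preimage, Set.mem_Iio, Set.mem_ofPred_eq, abs_mul, abs_of_pos hσpos, ← hσ]
      rw [sub_neg, mul_comm q, mul_lt_mul_iff_right₀ hσpos]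
    rw [hset, ← ofReal_measureReal]
    exact ENNReal.ofReal_le_ofReal (le_gaussianReal_abs_lt_quantile hα)
  have hle := hleft.trans hopen
  refine le_of_forall_lt fun c hc => ?_
  obtain ⟨c', hcc', hc'⟩ := exists_between hc
  refine hcc'.trans_le (le_liminf_of_le (isCoboundedUnder_ge_measureReal _) ?_)
  -- When `c' > 0`, also `1 - 2 * α > 0`, as strict comparison through `ENNReal.ofReal` requires.
  rcases le_or_gt c' 0 with hc0 | hc0
  · exact Eventually.of_forall fun N => hc0.trans measureReal_nonneg
  have hlt := lt_of_lt_of_le ((ENNReal.ofReal_lt_ofReal_iff (by linarith)).2 hc') hle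
  filter_upwards [eventually_lt_of_lt_liminf hlt, eventually_gt_atTop 0] with N hN hN0
  rw [Measure.map_apply_of_aemeasurable (hslutsky.forall_aemeasurable N) measurableSet_Iio] at hN
  refine (ENNReal.ofReal_le_iff_le_toReal (measure_ne_top _ _)).1 ?_
  refine hN.le.trans (measure_mono fun ω hω => ?_)
  simp only [Set.mem_preimage, Set.mem_Iio, hm] at hω
  simp only [Set.mem_ofPred_eq, sampleMean_eq_div]
  exact abs_sub_le_mul_sqrt_div_of_lt hN0 hω

end ConfidenceInterval

/-! ### Coverage for functions of `Y` and its resampled counterpart -/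

namespace IsMonteCarloSample

variable {Ω Ω' E F : Type*} [MeasurableSpace Ω] [MeasurableSpace Ω'] [MeasurableSpace E]
  [MeasurableSpace F] {μ : Measure Ω} {X : Ω → E} {Y : Ω → ℝ}
  {V : Ω → F} {h : E × F → ℝ} {Q : Measure Ω'} [IsProbabilityMeasure Q]
  {Xs : ℕ → Ω' → E} {Ys : ℕ → Ω' → ℝ} {Vs Vt : ℕ → Ω' → F}

/-- Asymptotic coverage of the confidence interval for the mean of a function of `Y` and its
resampled counterpart `h (X, V')`. -/
theorem le_liminf_measureReal (hs : IsMonteCarloSample μ X Y V Q Xs Ys Vs Vt)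
    (hh : Measurable h) {φ : ℝ × ℝ → ℝ} (hφ : Measurable φ)
    (hmem : MemLp (fun ω => φ (Ys 0 ω, h (Xs 0 ω, Vt 0 ω))) 2 Q) {m : ℝ}
    (hm : ∫ ω, φ (Ys 0 ω, h (Xs 0 ω, Vt 0 ω)) ∂Q = m) {α : ℝ} (hα : α ∈ Set.Ioo (0 : ℝ) 1) :
    1 - 2 * α ≤ liminf (fun N : ℕ => Q.real {ω |
        |m - sampleMean (fun n => φ (Ys n ω, h (Xs n ω, Vt n ω))) N|
          ≤ stdNormalQuantile (1 - α)
            * √(sampleVariance (fun n => φ (Ys n ω, h (Xs n ω, Vt n ω))) N / N)}) atTop := by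
  have hψ : Measurable fun p : (E × ℝ × F) × F => φ (p.1.2.1, h (p.1.1, p.2)) := by fun_prop
  have hX := hs.measurable_X
  have hY := hs.measurable_Y
  have hVt := hs.measurable_Vt
  exact le_liminf_measureReal_abs_sub_sampleMean_le
    (W := fun n ω => φ (Ys n ω, h (Xs n ω, Vt n ω))) (fun n => by fun_prop) hmem
    (hs.iIndepFun_prodMk.comp (fun _ p => φ (p.1.2.1, h (p.1.1, p.2))) fun _ => hψ)
    (fun n => (hs.identDistrib_prodMk n).comp hψ) hm hα

end IsMonteCarloSample

/-! ### Fourth moments and conclusion -/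

theorem memLp_four_of_integrable_pow {Ω : Type*} [MeasurableSpace Ω] {μ : Measure Ω} {Y : Ω → ℝ}
    (hY : AEStronglyMeasurable Y μ) (h : Integrable (fun ω => Y ω ^ 4) μ) : MemLp Y 4 μ := by
  rw [← integrable_norm_rpow_iff hY (by norm_num) (by norm_num)]
  refine h.congr (ae_of_all _ fun ω => ?_)
  have : (4 : ℝ≥0∞).toReal = ((4 : ℕ) : ℝ) := by norm_num
  simp only [this]
  rw [Real.rpow_natCast, Real.norm_eq_abs, Even.pow_abs (by decide)]

theorem mainTheorem4
    {d k : ℕ}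
    {Ω : Type*} [MeasurableSpace Ω] (P : Measure Ω) [IsProbabilityMeasure P]
    (X : Ω → (Fin d → ℝ)) (hX : Measurable X)
    (Y : Ω → ℝ) (hY : Measurable Y) (hYint : Integrable Y P)
    -- the regression function of `Y` on `X`
    (fbar : (Fin d → ℝ) → ℝ) (hfbar : IsRegressionFunction P X Y fbar)
    -- the distorted law `ν` of `X` and the disintegration of `P` along `X`
    (κ : Kernel (Fin d → ℝ) Ω) (hκ : IsRegularConditional P X κ)
    (ν : Measure (Fin d → ℝ)) [IsProbabilityMeasure ν] (hν : ν ≪ P.map X)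
    -- the representation `Y = h(X, V)` with `V` independent of `X` under the distorted measure
    (h : (Fin d → ℝ) × (Fin k → ℝ) → ℝ) (hh : Measurable h)
    (V : Ω → (Fin k → ℝ)) (hV : Measurable V)
    (hXV : IndepFun X V (distortedMeasure κ ν))
    (hYh : ∀ᵐ ω ∂(distortedMeasure κ ν), Y ω = h (X ω, V ω))
    (hY4 : Integrable (fun ω => Y ω ^ 4) (distortedMeasure κ ν))
    -- the Monte Carlo sample
    {Ω' : Type*} [MeasurableSpace Ω'] (Q : Measure Ω') [IsProbabilityMeasure Q]
    (Xs : ℕ → Ω' → (Fin d → ℝ)) (Ys : ℕ → Ω' → ℝ) (Vs Vt : ℕ → Ω' → (Fin k → ℝ))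
    (hsample : IsMonteCarloSample (distortedMeasure κ ν) X Y V Q Xs Ys Vs Vt)
    (Zs : ℕ → Ω' → ℝ) (hZs : ∀ n ω, Zs n ω = h (Xs n ω, Vt n ω))
    (α : ℝ) (hα : α ∈ Set.Ioo (0 : ℝ) 1) :
    1 - 2 * α ≤ liminf (fun N : ℕ => Q.real {ω |
        |regressionSqNorm (distortedMeasure κ ν) X fbar
            - sampleMean (fun n => Ys n ω * Zs n ω) N|
          ≤ stdNormalQuantile (1 - α)
            * √(sampleVariance (fun n => Ys n ω * Zs n ω) N / N)}) atTop
    ∧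
    1 - 2 * α ≤ liminf (fun N : ℕ => Q.real {ω |
        |minMeanSqDist (distortedMeasure κ ν) X Y
            - sampleMean (fun n => Ys n ω * (Ys n ω - Zs n ω)) N|
          ≤ stdNormalQuantile (1 - α)
            * √(sampleVariance (fun n => Ys n ω * (Ys n ω - Zs n ω)) N / N)}) atTop := by
  have := hκ.1
  have := isProbabilityMeasure_distortedMeasure hκ.1 ν
  set μ := distortedMeasure κ ν
  obtain rfl : Zs = fun n ω => h (Xs n ω, Vt n ω) := funext fun n => funext (hZs n)
  have hYL4 : MemLp Y 4 μ := memLp_four_of_integrable_pow hY.aestronglyMeasurable hY4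
  have hYL2 : MemLp Y 2 μ := hYL4.mono_exponent (by norm_num)
  have hg : IsRegressionFunction μ X Y fbar :=
    hfbar.distortedMeasure hX hY hYint hκ hν (hYL2.integrable one_le_two)
  have hident := hsample.identDistrib_resampled hh hXV hY.aemeasurable hYh 0
  have hY4s : MemLp (Ys 0) 4 Q := (hsample.identDistrib_Y 0).memLp_iff.2 hYL4
  have hZ4s : MemLp (fun ω => h (Xs 0 ω, Vt 0 ω)) 4 Q := hident.memLp_iff.2 hYL4
  -- Hölder with `1/4 + 1/4 = 1/2`: products of two `L⁴` variables are in `L²`.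
  have hholder : ENNReal.HolderTriple 4 4 2 := ⟨by
    rw [show (4 : ℝ≥0∞) = 2 * 2 by norm_num, ENNReal.mul_inv (by simp) (by simp), ← mul_add,
      ENNReal.inv_two_add_inv_two, mul_one]⟩
  have hprod : MemLp (fun ω => Ys 0 ω * h (Xs 0 ω, Vt 0 ω)) 2 Q := hZ4s.mul' hY4s
  have hsq : MemLp (fun ω => Ys 0 ω * Ys 0 ω) 2 Q := hY4s.mul' hY4s
  have hmean := hsample.integral_mul_resampled hg hX hY hV hh hXV hYh hYL2 0
  have hmeanSq : ∫ ω, Ys 0 ω * Ys 0 ω ∂Q = ∫ ω, Y ω ^ 2 ∂μ := by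
    simp only [sq]
    exact ((hsample.identDistrib_Y 0).comp (u := fun y => y * y) (by fun_prop)).integral_eq
  refine ⟨hsample.le_liminf_measureReal hh (φ := fun p => p.1 * p.2) (by fun_prop) hprod hmean hα,
    hsample.le_liminf_measureReal hh (φ := fun p => p.1 * (p.1 - p.2)) (by fun_prop) ?_ ?_ hα⟩
  · simpa only [mul_sub] using! hsq.sub hprod
  -- The mean of `Y(Y - Z)` is `E[Y²] - E[YZ]`, which is the minimal distance.
  · rw [hg.minMeanSqDist_eq hX hY hYL2, ← hmean, ← hmeanSq,
      ← integral_sub (hsq.integrable one_le_two) (hprod.integrable one_le_two)]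
    simp only [mul_sub]
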